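/- **Theorem 3.1.** Let $\mathbb{D}$ be the open unit disc and $dA=\frac1\pi\,dx\,dy$. For $p>0$ let $\mathcal{D}_p(\mathbb{D})$ be the space of holomorphic functions $f$ on $\mathbb{D}$ with $$D_p(f):=\int_{\mathbb{D}}|f'(z)|^2(1-|z|^2)^p\,dA(z)<\infty ,$$ with norm $\|f\|_{\mathcal{D}_p}=\big(|f(0)|^2+D_p(f)\big)^{1/2}$. Let $\sigma>0$ and $\frac{\sigma}{2}-1<\beta<\sigma$, and put $p=2\sigma-2\beta$. Then there is a constant $C>0$, depending only on $\sigma$ and $\beta$, with the following property. Let $\varphi:\mathbb{D}\to\mathbb{D}$ be holomorphic and of class $C^1$ up to the boundary (that is, $\varphi\in C^1(\overline{\mathbb{D}})$), and suppose that the kernel $$k^{\varphi}(z,w)=\frac{1-\varphi(z)\overline{\varphi(w)}}{1-z\overline{w}}$$ satisfies $\|k^\varphi\|_\infty:=\sup_{(z,w)\in\mathbb{D}^2}|k^\varphi(z,w)|<\infty$. Then the composition operator $C_\varphi f=f\circ\varphi$ maps $\mathcal{D}_p(\mathbb{D})$ into itself and is bounded there, and for every $f\in\mathcal{D}_p(\mathbb{D})$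 $$D_p(f\circ\varphi)\le C\,\|k^\varphi\|_\infty^{2(\beta+2)}\,D_p(f)\qquad\text{and}\qquad \|f\circ\varphi\|_{\mathcal{D}_p}^2\le C\,\|k^\varphi\|_\infty^{2(\beta+2)}\,\|f\|_{\mathcal{D}_p}^2 .$$ -/

import Mathlib

open Complex Metric MeasureTheory Set

noncomputable section

namespace DirichletDisc

/-- The open unit disc of the complex plane. Functions on the disc are represented by total
functions on the plane; only their values on the disc are used below. -/
def disc : Set ℂ := ball (0 : ℂ) 1

/-- Holomorphic self-maps of the unit disc that are of class `C¹` up to the boundary: `φ` is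
holomorphic on the open disc, maps it to itself, and is continuously (real) differentiable on the
closed disc. -/
structure IsC1SelfMap (φ : ℂ → ℂ) : Prop where
  holo : DifferentiableOn ℂ φ disc
  mapsTo : MapsTo φ disc disc
  contDiff : ContDiffOn ℝ 1 φ (closedBall (0 : ℂ) 1)

/-- The de Branges–Rovnyak kernel `(1 - φ(z) conj φ(w)) / (1 - z conj w)`. -/
def kernel (φ : ℂ → ℂ) (z w : ℂ) : ℂ :=
  (1 - φ z * (starRingEnd ℂ) (φ w)) / (1 - z * (starRingEnd ℂ) w)

/-- The set of values `|k^φ(z,w)|` for `(z,w)` in the bidisc. -/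
def kernelValues (φ : ℂ → ℂ) : Set ℝ :=
  (fun q : ℂ × ℂ => ‖kernel φ q.1 q.2‖) '' (disc ×ˢ disc)

/-- The supremum norm of the kernel over the bidisc (meaningful when the set of values is
bounded above). -/
def kernelSup (φ : ℂ → ℂ) : ℝ := sSup (kernelValues φ)

/-- Membership in the Dirichlet-type space: `f` is holomorphic on the disc and
`∫_𝔻 |f'(z)|² (1 - |z|²)^p dA(z) < ∞`. -/
def MemDirichlet (p : ℝ) (f : ℂ → ℂ) : Prop :=
  DifferentiableOn ℂ f disc ∧
    IntegrableOn (fun z : ℂ => ‖deriv f z‖ ^ 2 * (1 - ‖z‖ ^ 2) ^ p) disc volume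

/-- The Dirichlet-type integral `∫_𝔻 |f'(z)|² (1 - |z|²)^p dA(z)`, where `dA = dx dy / π`. -/
def dirichletIntegral (p : ℝ) (f : ℂ → ℂ) : ℝ :=
  (1 / Real.pi) * ∫ z in disc, ‖deriv f z‖ ^ 2 * (1 - ‖z‖ ^ 2) ^ p

/-- The norm `(|f(0)|² + ∫_𝔻 |f'(z)|² (1 - |z|²)^p dA(z))^{1/2}` of the Dirichlet-type space. -/
def dirichletNorm (p : ℝ) (f : ℂ → ℂ) : ℝ :=
  Real.sqrt (‖f 0‖ ^ 2 + dirichletIntegral p f)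

/-- The composition operator `f ↦ f ∘ φ` maps the Dirichlet-type space to itself and is bounded
for its norm. -/
def BoundedComposition (p : ℝ) (φ : ℂ → ℂ) : Prop :=
  ∃ M : ℝ, ∀ f : ℂ → ℂ, MemDirichlet p f →
    MemDirichlet p (f ∘ φ) ∧ dirichletNorm p (f ∘ φ) ≤ M * dirichletNorm p f

end DirichletDisc

end

/-! Write K for `kernelSup φ`. On the diagonal the kernel bound reads 1 - |φ(z)|² ≤ K(1 - |z|²), so
φ is unimodular on the circle. For finitely many preimages a of w, the function (φ - w)/(1 - w̄φ) is
dominated by the Blaschke product with zeros a. Comparing how fast both moduli tend to 1 at a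
boundary point ζ gives Σ P_a(ζ) ≤ K P_w(φ(ζ)), where P is the Poisson kernel (`sum_poisson_le`).

Two bounds follow. Taking φ(ζ) = -w/|w| yields Σ (1 - |a|²) ≤ 4K(1 - |w|²). The maximum principle,
evaluated at 0, bounds the number of preimages by (4K)². Interpolating between them gives Σ (1 -
|a|²)^p ≤ 2(4K)^q (1 - |w|²)^p with q = 2(β + 2) (`sum_one_sub_norm_sq_rpow_le`).

The substitution w = φ(z), counted with preimages (`lintegral_comp_mul_le`), turns this into the
bound on D_p(f ∘ φ). For the norm, f(φ(0)) is controlled by the growth estimate `norm_sub_sq_le`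
together with 1/(1 - |φ(0)|) ≤ 8K. -/

namespace DirichletDisc
open scoped ComplexConjugate Topology
open Filter

/-! ### Maximum principle and finite Blaschke products -/

/-- Maximum principle for the real part of a holomorphic function on the unit disc. -/
theorem re_nonpos_of_re_nonpos_on_sphere {H : ℂ → ℂ} (hH : DiffContOnCl ℂ H (ball 0 1))
    (hs : ∀ z ∈ sphere (0 : ℂ) 1, (H z).re ≤ 0) {z : ℂ} (hz : z ∈ closedBall (0 : ℂ) 1) :
    (H z).re ≤ 0 := by
  have hd : DiffContOnCl ℂ (fun z => exp (H z)) (ball 0 1) :=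
    ⟨hH.differentiableOn.cexp, hH.continuousOn.cexp⟩
  have := norm_le_of_forall_mem_frontier_norm_le isBounded_ball hd (C := 1) (z := z) ?_ ?_
  · simpa [norm_exp] using this
  · intro w hw
    rw [frontier_ball _ one_ne_zero] at hw
    simpa [norm_exp] using hs w hw
  · rwa [closure_ball _ one_ne_zero]

/-- The real part of the Herglotz kernel. -/
theorem re_one_add_div_one_sub (u : ℂ) :
    ((1 + u) / (1 - u)).re = (1 - ‖u‖ ^ 2) / ‖1 - u‖ ^ 2 := by
  rw [div_re, ← normSq_eq_norm_sq, ← normSq_eq_norm_sq, ← add_div]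
  congr 1
  simp [normSq_apply]
  ring

theorem one_sub_conj_mul_ne_zero {a z : ℂ} (ha : ‖a‖ < 1) (hz : ‖z‖ ≤ 1) :
    1 - conj a * z ≠ 0 := by
  intro h
  have h1 : ‖conj a * z‖ = 1 := by rw [← sub_eq_zero.mp h, norm_one]
  rw [norm_mul, RCLike.norm_conj] at h1
  nlinarith [norm_nonneg a, norm_nonneg z]

theorem norm_one_sub_conj_mul_sq_sub (a z : ℂ) :
    ‖1 - conj a * z‖ ^ 2 - ‖z - a‖ ^ 2 = (1 - ‖a‖ ^ 2) * (1 - ‖z‖ ^ 2) := by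
  simp only [← normSq_eq_norm_sq, normSq_apply]
  simp
  ring

theorem norm_sub_eq_norm_one_sub_conj_mul (a : ℂ) {z : ℂ} (hz : ‖z‖ = 1) :
    ‖z - a‖ = ‖1 - conj a * z‖ := by
  have := norm_one_sub_conj_mul_sq_sub a z
  rw [hz] at this
  have h2 : ‖z - a‖ ^ 2 = ‖1 - conj a * z‖ ^ 2 := by linarith
  exact (pow_left_inj₀ (norm_nonneg _) (norm_nonneg _) two_ne_zero).mp h2

/-- Schwarz lemma for a function with several prescribed zeros: it is dominated by the Blaschke
product of these zeros. -/
theorem norm_le_prod_of_zeros (s : Finset ℂ) (hs : ∀ a ∈ s, ‖a‖ < 1) :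
    ∀ F : ℂ → ℂ, DiffContOnCl ℂ F (ball 0 1) → (∀ z ∈ sphere (0 : ℂ) 1, ‖F z‖ ≤ 1) →
      (∀ a ∈ s, F a = 0) → ∀ z ∈ closedBall (0 : ℂ) 1,
      ‖F z‖ ≤ ∏ a ∈ s, ‖(z - a) / (1 - conj a * z)‖ := by
  classical
  induction s using Finset.induction_on with
  | empty =>
    intro F hF hb _ z hz
    simp only [Finset.prod_empty]
    refine norm_le_of_forall_mem_frontier_norm_le isBounded_ball hF ?_
      (by rwa [closure_ball _ one_ne_zero])
    rwa [frontier_ball _ one_ne_zero]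
  | insert a s has ih =>
    intro F hF hb h0 z hz
    have ha : ‖a‖ < 1 := hs a (Finset.mem_insert_self _ _)
    have haF : F a = 0 := h0 a (Finset.mem_insert_self _ _)
    have hnhds : ball (0 : ℂ) 1 ∈ 𝓝 a := isOpen_ball.mem_nhds (by simpa using ha)
    have hFc : ContinuousOn F (closedBall 0 1) := by
      simpa [closure_ball (0 : ℂ) one_ne_zero] using hF.continuousOn
    have hmul : ∀ z, F z = (z - a) * dslope F a z := by
      intro z
      have := sub_smul_dslope F a z
      simpa [haF] using this.symm
    -- Here h is F divided by the Blaschke factor at a. That factor is unimodular on the circle, so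
    -- the boundary bound survives, and the other zeros remain.
    set h : ℂ → ℂ := fun z => dslope F a z * (1 - conj a * z) with hh
    have hhd : DiffContOnCl ℂ h (ball 0 1) := by
      constructor
      · exact ((differentiableOn_dslope hnhds).mpr hF.differentiableOn).mul (by fun_prop)
      · rw [closure_ball _ one_ne_zero]
        refine ContinuousOn.mul ((continuousOn_dslope
          (mem_of_superset hnhds ball_subset_closedBall)).mpr
          ⟨hFc, hF.differentiableOn.differentiableAt hnhds⟩) (by fun_prop)
    have hhb : ∀ z ∈ sphere (0 : ℂ) 1, ‖h z‖ ≤ 1 := by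
      intro z hz
      have hz1 : ‖z‖ = 1 := by simpa using hz
      have := hb z hz
      rw [hmul z, norm_mul, norm_sub_eq_norm_one_sub_conj_mul a hz1, mul_comm, ← norm_mul] at this
      exact this
    have hh0 : ∀ b ∈ s, h b = 0 := by
      intro b hb'
      have hba : b - a ≠ 0 := sub_ne_zero.mpr (fun e => has (e ▸ hb'))
      have := hmul b
      rw [h0 b (Finset.mem_insert_of_mem hb')] at this
      have h3 : dslope F a b = 0 := by
        rcases mul_eq_zero.mp this.symm with h | h
        · exact absurd h hba
        · exact h
      simp [hh, h3]
    have key := ih (fun b hb => hs b (Finset.mem_insert_of_mem hb)) h hhd hhb hh0 z hz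
    rw [Finset.prod_insert has]
    have hz1 : ‖z‖ ≤ 1 := by simpa using hz
    have hne := one_sub_conj_mul_ne_zero ha hz1
    have : F z = (z - a) / (1 - conj a * z) * h z := by
      rw [hmul z, hh, div_mul_eq_mul_div, eq_div_iff hne]; ring
    rw [this, norm_mul]
    gcongr

/-- Boundary behaviour of finite Blaschke products. -/
theorem tendsto_one_sub_prod_div (s : Finset ℂ) (hs : ∀ a ∈ s, ‖a‖ < 1) {ζ : ℂ}
    (hζ : ‖ζ‖ = 1) :
    Tendsto (fun z : ℂ => (1 - ∏ a ∈ s, ‖(z - a) / (1 - conj a * z)‖ ^ 2) / (1 - ‖z‖ ^ 2))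
      (𝓝[ball 0 1] ζ) (𝓝 (∑ a ∈ s, (1 - ‖a‖ ^ 2) / ‖1 - conj a * ζ‖ ^ 2)) := by
  classical
  induction s using Finset.induction_on with
  | empty => simpa using tendsto_const_nhds
  | insert a s has ih =>
    have ha : ‖a‖ < 1 := hs a (Finset.mem_insert_self _ _)
    have hne := one_sub_conj_mul_ne_zero ha hζ.le
    have h1 := ih (fun b hb => hs b (Finset.mem_insert_of_mem hb))
    have hb : Tendsto (fun z : ℂ => ‖(z - a) / (1 - conj a * z)‖ ^ 2) (𝓝[ball 0 1] ζ) (𝓝 1) := by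
      have hc : ContinuousAt (fun z : ℂ => ‖(z - a) / (1 - conj a * z)‖ ^ 2) ζ := by
        have h2 : ContinuousAt (fun z : ℂ => 1 - conj a * z) ζ := by fun_prop
        have h3 : ContinuousAt (fun z : ℂ => z - a) ζ := by fun_prop
        exact ((h3.div h2 hne).norm).pow 2
      have h4 : ‖(ζ - a) / (1 - conj a * ζ)‖ ^ 2 = 1 := by
        rw [norm_div, norm_sub_eq_norm_one_sub_conj_mul a hζ,
          div_self (norm_ne_zero_iff.mpr hne), one_pow]
      rw [← h4]
      exact hc.tendsto.mono_left nhdsWithin_le_nhds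
    have hx : Tendsto (fun z : ℂ => (1 - ‖a‖ ^ 2) / ‖1 - conj a * z‖ ^ 2) (𝓝[ball 0 1] ζ)
        (𝓝 ((1 - ‖a‖ ^ 2) / ‖1 - conj a * ζ‖ ^ 2)) := by
      have hc : ContinuousAt (fun z : ℂ => (1 - ‖a‖ ^ 2) / ‖1 - conj a * z‖ ^ 2) ζ :=
        ContinuousAt.div (by fun_prop) (by fun_prop) (pow_ne_zero _ (norm_ne_zero_iff.mpr hne))
      exact hc.tendsto.mono_left nhdsWithin_le_nhds
    rw [Finset.sum_insert has]
    -- With b the new factor and P the old product, 1 - bP = (1 - b) + b(1 - P), where b → 1 and (1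
    -- - b)/(1 - |z|²) tends to the Poisson kernel of a at ζ.
    have := hx.add (hb.mul h1)
    rw [one_mul] at this
    refine this.congr' ?_
    filter_upwards [self_mem_nhdsWithin] with z hz
    have hz1 : ‖z‖ < 1 := by simpa using hz
    have hz2 : (1 - ‖z‖ ^ 2) ≠ 0 := by nlinarith [norm_nonneg z]
    have hne' := norm_ne_zero_iff.mpr (one_sub_conj_mul_ne_zero ha hz1.le)
    rw [Finset.prod_insert has]
    have e := norm_one_sub_conj_mul_sq_sub a z
    have e2 : (1 - ‖a‖ ^ 2) / ‖1 - conj a * z‖ ^ 2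
        = (1 - ‖(z - a) / (1 - conj a * z)‖ ^ 2) / (1 - ‖z‖ ^ 2) := by
      rw [norm_div, div_pow, div_eq_div_iff (pow_ne_zero 2 hne') hz2, ← e, sub_mul,
        div_mul_cancel₀ _ (pow_ne_zero 2 hne'), one_mul]
    rw [e2, mul_div_assoc', ← add_div]
    ring_nf

/-! ### Self-maps with bounded kernel: boundary values and preimages -/

section SelfMap
variable {φ : ℂ → ℂ}

theorem IsC1SelfMap.diffContOnCl (hφ : IsC1SelfMap φ) : DiffContOnCl ℂ φ (ball 0 1) :=
  ⟨hφ.holo, by rw [closure_ball _ one_ne_zero]; exact hφ.contDiff.continuousOn⟩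

theorem IsC1SelfMap.norm_lt_one (hφ : IsC1SelfMap φ) {z : ℂ} (hz : ‖z‖ < 1) : ‖φ z‖ < 1 := by
  simpa [disc] using hφ.mapsTo (show z ∈ disc by simpa [disc] using hz)

theorem IsC1SelfMap.tendsto (hφ : IsC1SelfMap φ) {ζ : ℂ} (hζ : ‖ζ‖ = 1) :
    Tendsto φ (𝓝[ball 0 1] ζ) (𝓝 (φ ζ)) :=
  (hφ.contDiff.continuousOn ζ (by simp [hζ])).mono ball_subset_closedBall

theorem nhdsWithin_ball_neBot {ζ : ℂ} (hζ : ‖ζ‖ = 1) : (𝓝[ball (0 : ℂ) 1] ζ).NeBot := by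
  rw [← mem_closure_iff_nhdsWithin_neBot, closure_ball _ one_ne_zero]
  simp [hζ]

/-- The diagonal value of the kernel is the positive number (1 - |φ(z)|²)/(1 - |z|²). -/
theorem one_sub_norm_sq_le (hφ : IsC1SelfMap φ) (hK : BddAbove (kernelValues φ)) {z : ℂ}
    (hz : ‖z‖ < 1) : 1 - ‖φ z‖ ^ 2 ≤ kernelSup φ * (1 - ‖z‖ ^ 2) := by
  have hzd : z ∈ disc := by simpa [disc] using hz
  have hle : ‖kernel φ z z‖ ≤ kernelSup φ := le_csSup hK ⟨(z, z), ⟨hzd, hzd⟩, rfl⟩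
  have hpos : 0 < 1 - ‖z‖ ^ 2 := by nlinarith [norm_nonneg z]
  have hpos' : 0 < 1 - ‖φ z‖ ^ 2 := by nlinarith [norm_nonneg (φ z), hφ.norm_lt_one hz]
  have : kernel φ z z = (((1 - ‖φ z‖ ^ 2) / (1 - ‖z‖ ^ 2) : ℝ) : ℂ) := by
    simp [kernel, mul_conj, normSq_eq_norm_sq]
  rw [this, norm_real, Real.norm_of_nonneg (by positivity), div_le_iff₀ hpos] at hle
  exact hle

theorem norm_eq_one_of_norm_eq_one (hφ : IsC1SelfMap φ) (hK : BddAbove (kernelValues φ)) {ζ : ℂ}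
    (hζ : ‖ζ‖ = 1) : ‖φ ζ‖ = 1 := by
  have := nhdsWithin_ball_neBot hζ
  have hn : Tendsto (fun z : ℂ => ‖z‖) (𝓝[ball 0 1] ζ) (𝓝 1) := by
    rw [← hζ]; exact (continuous_norm.tendsto ζ).mono_left nhdsWithin_le_nhds
  have ht := (hφ.tendsto hζ).norm
  apply le_antisymm
  · refine le_of_tendsto ht ?_
    filter_upwards [self_mem_nhdsWithin] with z hz
    exact (hφ.norm_lt_one (by simpa using hz)).le
  · have h1 : 1 - ‖φ ζ‖ ^ 2 ≤ kernelSup φ * (1 - 1 ^ 2) := by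
      refine le_of_tendsto_of_tendsto ((ht.pow 2).const_sub 1)
        (((hn.pow 2).const_sub 1).const_mul _) ?_
      filter_upwards [self_mem_nhdsWithin] with z hz
      exact one_sub_norm_sq_le hφ hK (by simpa using hz)
    nlinarith [norm_nonneg (φ ζ)]

/-- A self-map with bounded kernel maps the unit circle onto itself. -/
theorem exists_boundary_preimage (hφ : IsC1SelfMap φ) (hK : BddAbove (kernelValues φ)) {u : ℂ}
    (hu : ‖u‖ = 1) : ∃ ζ : ℂ, ‖ζ‖ = 1 ∧ φ ζ = u := by
  by_contra! hcon
  have hu0 : u ≠ 0 := by rintro rfl; simp at hu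
  have hne : ∀ z ∈ closedBall (0 : ℂ) 1, 1 - conj u * φ z ≠ 0 := by
    intro z hz h
    have hz1 : ‖z‖ ≤ 1 := by simpa using hz
    have hφu : φ z = u := by
      have : conj u * φ z = conj u * u := by
        rw [← sub_eq_zero.mp h, mul_comm, mul_conj, normSq_eq_norm_sq, hu]; simp
      exact mul_left_cancel₀ ((map_ne_zero _).mpr hu0) this
    rcases hz1.lt_or_eq with h1 | h1
    · have := hφ.norm_lt_one h1
      rw [hφu, hu] at this
      exact lt_irrefl _ this
    · exact hcon z h1 hφu
  have hd := hφ.diffContOnCl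
  have hcl : closure (ball (0 : ℂ) 1) = closedBall 0 1 := closure_ball _ one_ne_zero
  -- If φ omits u on the circle, this function is continuous up to the boundary with real part 0
  -- there, whereas its real part at 0 is positive.
  have hH : DiffContOnCl ℂ (fun z => (1 + conj u * φ z) / (1 - conj u * φ z)) (ball 0 1) := by
    constructor
    · exact ((hd.differentiableOn.const_mul _).const_add _).div
        ((hd.differentiableOn.const_mul _).const_sub _)
        (fun z hz => hne z (ball_subset_closedBall hz))
    · exact (continuousOn_const.add (continuousOn_const.mul hd.continuousOn)).div
        (continuousOn_const.sub (continuousOn_const.mul hd.continuousOn))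
        (fun z hz => hne z (hcl ▸ hz))
  have h0 := re_nonpos_of_re_nonpos_on_sphere hH (fun z hz => by
    have hz1 : ‖z‖ = 1 := by simpa using hz
    rw [re_one_add_div_one_sub]
    simp [hu, norm_eq_one_of_norm_eq_one hφ hK hz1]) (mem_closedBall_self zero_le_one)
  rw [re_one_add_div_one_sub] at h0
  have h1 : 0 < ‖1 - conj u * φ 0‖ := norm_pos_iff.mpr (hne 0 (mem_closedBall_self zero_le_one))
  have h2 : ‖conj u * φ 0‖ < 1 := by
    rw [norm_mul, RCLike.norm_conj, hu, one_mul]; exact hφ.norm_lt_one (by simp)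
  have h3 : 0 < 1 - ‖conj u * φ 0‖ ^ 2 := by nlinarith [norm_nonneg (conj u * φ 0)]
  exact absurd h0 (not_le.mpr (by positivity))

/-- Poisson kernels at preimages of `w` are dominated on the circle by the Poisson kernel at `w`
composed with the map. -/
theorem sum_poisson_le (hφ : IsC1SelfMap φ) (hK : BddAbove (kernelValues φ)) (s : Finset ℂ)
    {w : ℂ} (hs : ∀ a ∈ s, ‖a‖ < 1) (hsw : ∀ a ∈ s, φ a = w) (hw : ‖w‖ < 1) {ζ : ℂ}
    (hζ : ‖ζ‖ = 1) :
    ∑ a ∈ s, (1 - ‖a‖ ^ 2) / ‖1 - conj a * ζ‖ ^ 2 ≤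
      kernelSup φ * ((1 - ‖w‖ ^ 2) / ‖1 - conj w * φ ζ‖ ^ 2) := by
  have := nhdsWithin_ball_neBot hζ
  have hd := hφ.diffContOnCl
  have hcl : closure (ball (0 : ℂ) 1) = closedBall 0 1 := closure_ball _ one_ne_zero
  have hφ1 : ∀ z ∈ closedBall (0 : ℂ) 1, ‖φ z‖ ≤ 1 := by
    intro z hz
    have hz1 : ‖z‖ ≤ 1 := by simpa using hz
    rcases hz1.lt_or_eq with h | h
    · exact (hφ.norm_lt_one h).le
    · exact (norm_eq_one_of_norm_eq_one hφ hK h).le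
  have hne : ∀ z ∈ closedBall (0 : ℂ) 1, 1 - conj w * φ z ≠ 0 :=
    fun z hz => one_sub_conj_mul_ne_zero hw (hφ1 z hz)
  have hF : DiffContOnCl ℂ (fun z => (φ z - w) / (1 - conj w * φ z)) (ball 0 1) := by
    constructor
    · exact (hd.differentiableOn.sub_const _).div
        ((hd.differentiableOn.const_mul _).const_sub _)
        (fun z hz => hne z (ball_subset_closedBall hz))
    · exact (hd.continuousOn.sub continuousOn_const).div
        (continuousOn_const.sub (continuousOn_const.mul hd.continuousOn))
        (fun z hz => hne z (hcl ▸ hz))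
  have hprod := norm_le_prod_of_zeros s hs _ hF (fun z hz => by
    have hz1 : ‖z‖ = 1 := by simpa using hz
    rw [norm_div, norm_sub_eq_norm_one_sub_conj_mul w (norm_eq_one_of_norm_eq_one hφ hK hz1)]
    exact div_self_le_one _) (fun a ha => by simp [hsw a ha])
  have hr : Tendsto (fun z => kernelSup φ * ((1 - ‖w‖ ^ 2) / ‖1 - conj w * φ z‖ ^ 2))
      (𝓝[ball 0 1] ζ) (𝓝 (kernelSup φ * ((1 - ‖w‖ ^ 2) / ‖1 - conj w * φ ζ‖ ^ 2))) := by
    refine Tendsto.const_mul _ (Tendsto.div tendsto_const_nhds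
      ((((hφ.tendsto hζ).const_mul _).const_sub 1).norm.pow 2) ?_)
    exact pow_ne_zero _ (norm_ne_zero_iff.mpr (hne ζ (by simp [hζ])))
  -- The Blaschke domination is rewritten as an inequality for 1 - |·|², divided by 1 - |z|², and
  -- passed to the limit z → ζ.
  refine le_of_tendsto_of_tendsto (tendsto_one_sub_prod_div s hs hζ) hr ?_
  filter_upwards [self_mem_nhdsWithin] with z hz
  have hz1 : ‖z‖ < 1 := by simpa using hz
  have hzc : z ∈ closedBall (0 : ℂ) 1 := ball_subset_closedBall hz
  have hz2 : 0 < 1 - ‖z‖ ^ 2 := by nlinarith [norm_nonneg z]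
  have hw2 : 0 < 1 - ‖w‖ ^ 2 := by nlinarith [norm_nonneg w]
  have hp := hprod z hzc
  have hp2 := pow_le_pow_left₀ (norm_nonneg _) hp 2
  rw [← Finset.prod_pow] at hp2
  have hpos : 0 < ‖1 - conj w * φ z‖ ^ 2 := pow_pos (norm_pos_iff.mpr (hne z hzc)) 2
  have e : 1 - ‖(φ z - w) / (1 - conj w * φ z)‖ ^ 2
      = (1 - ‖w‖ ^ 2) * (1 - ‖φ z‖ ^ 2) / ‖1 - conj w * φ z‖ ^ 2 := by
    rw [← norm_one_sub_conj_mul_sq_sub, norm_div, div_pow, eq_div_iff hpos.ne', sub_mul,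
      div_mul_cancel₀ _ hpos.ne', one_mul]
  rw [div_le_iff₀ hz2]
  calc 1 - ∏ a ∈ s, ‖(z - a) / (1 - conj a * z)‖ ^ 2
      ≤ (1 - ‖w‖ ^ 2) * (1 - ‖φ z‖ ^ 2) / ‖1 - conj w * φ z‖ ^ 2 := by rw [← e]; linarith
    _ ≤ (1 - ‖w‖ ^ 2) * (kernelSup φ * (1 - ‖z‖ ^ 2)) / ‖1 - conj w * φ z‖ ^ 2 := by
      gcongr; exact one_sub_norm_sq_le hφ hK hz1
    _ = _ := by ring

theorem kernelSup_nonneg (φ : ℂ → ℂ) : 0 ≤ kernelSup φ :=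
  Real.sSup_nonneg (by rintro _ ⟨q, -, rfl⟩; exact norm_nonneg _)

/-- The Poisson inequality is used at ζ with φ(ζ) = -w/|w|, antipodal to w, where the denominator on
the right is at least 1. On the left the denominators are at most 4. -/
theorem sum_one_sub_norm_sq_le (hφ : IsC1SelfMap φ) (hK : BddAbove (kernelValues φ))
    (s : Finset ℂ) {w : ℂ} (hs : ∀ a ∈ s, ‖a‖ < 1) (hsw : ∀ a ∈ s, φ a = w) (hw : ‖w‖ < 1) :
    ∑ a ∈ s, (1 - ‖a‖ ^ 2) ≤ 4 * kernelSup φ * (1 - ‖w‖ ^ 2) := by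
  have hw2 : 0 < 1 - ‖w‖ ^ 2 := by nlinarith [norm_nonneg w]
  obtain ⟨ζ, hζ, hφζ⟩ : ∃ ζ : ℂ, ‖ζ‖ = 1 ∧ 1 ≤ ‖1 - conj w * φ ζ‖ := by
    by_cases h0 : w = 0
    · exact ⟨1, by simp, by simp [h0]⟩
    · have hn : (‖w‖ : ℂ) ≠ 0 := by exact_mod_cast norm_ne_zero_iff.mpr h0
      obtain ⟨ζ, hζ, h⟩ := exists_boundary_preimage hφ hK (u := -(w / ‖w‖)) (by
        rw [norm_neg, norm_div, norm_real, norm_norm, div_self (norm_ne_zero_iff.mpr h0)])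
      refine ⟨ζ, hζ, ?_⟩
      have : 1 - conj w * φ ζ = ((1 + ‖w‖ : ℝ) : ℂ) := by
        rw [h]
        have : conj w * w = (‖w‖ : ℂ) ^ 2 := by
          rw [mul_comm, mul_conj, normSq_eq_norm_sq]; push_cast; rfl
        push_cast
        field_simp
        linear_combination this
      rw [this, norm_real, Real.norm_of_nonneg (by positivity)]
      linarith [norm_nonneg w]
  have h := sum_poisson_le hφ hK s hs hsw hw hζ
  have h1 : ∑ a ∈ s, (1 - ‖a‖ ^ 2) ≤ 4 * ∑ a ∈ s, (1 - ‖a‖ ^ 2) / ‖1 - conj a * ζ‖ ^ 2 := by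
    rw [Finset.mul_sum]
    refine Finset.sum_le_sum fun a ha => ?_
    have ha1 := hs a ha
    have hpos := norm_pos_iff.mpr (one_sub_conj_mul_ne_zero ha1 hζ.le)
    have hle : ‖1 - conj a * ζ‖ ≤ 2 := by
      refine (norm_sub_le _ _).trans ?_
      rw [norm_mul, RCLike.norm_conj, hζ, norm_one]; linarith
    have ha2 : 0 < 1 - ‖a‖ ^ 2 := by nlinarith [norm_nonneg a]
    rw [mul_div_assoc', le_div_iff₀ (by positivity)]
    nlinarith [mul_le_mul hle hle hpos.le zero_le_two]
  have h2 : (1 - ‖w‖ ^ 2) / ‖1 - conj w * φ ζ‖ ^ 2 ≤ 1 - ‖w‖ ^ 2 :=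
    div_le_self hw2.le (one_le_pow₀ hφζ)
  have := mul_le_mul_of_nonneg_left h2 (kernelSup_nonneg φ)
  linarith

/-- The point 0 is a single preimage of φ(0). -/
theorem one_le_kernelSup_mul (hφ : IsC1SelfMap φ) (hK : BddAbove (kernelValues φ)) :
    1 ≤ 4 * kernelSup φ * (1 - ‖φ 0‖ ^ 2) := by
  simpa using sum_one_sub_norm_sq_le hφ hK {0} (w := φ 0) (by simp) (by simp)
    (hφ.norm_lt_one (by simp))

theorem one_le_four_mul_kernelSup (hφ : IsC1SelfMap φ) (hK : BddAbove (kernelValues φ)) :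
    1 ≤ 4 * kernelSup φ := by
  nlinarith [one_le_kernelSup_mul hφ hK, kernelSup_nonneg φ,
    mul_nonneg (kernelSup_nonneg φ) (sq_nonneg ‖φ 0‖)]

theorem one_div_one_sub_norm_le (hφ : IsC1SelfMap φ) (hK : BddAbove (kernelValues φ)) :
    1 / (1 - ‖φ 0‖) ≤ 8 * kernelSup φ := by
  have h := hφ.norm_lt_one (z := 0) (by simp)
  rw [div_le_iff₀ (by linarith)]
  have := one_le_kernelSup_mul hφ hK
  nlinarith [mul_nonneg (kernelSup_nonneg φ) (sub_nonneg.mpr h.le), norm_nonneg (φ 0),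
    mul_nonneg (mul_nonneg (kernelSup_nonneg φ) (sub_nonneg.mpr h.le)) (sub_nonneg.mpr h.le)]

/-- The number of preimages of a point is controlled by the kernel. -/
theorem card_preimages_le (hφ : IsC1SelfMap φ) (hK : BddAbove (kernelValues φ))
    (s : Finset ℂ) {w : ℂ} (hs : ∀ a ∈ s, ‖a‖ < 1) (hsw : ∀ a ∈ s, φ a = w) (hw : ‖w‖ < 1) :
    (s.card : ℝ) ≤ (4 * kernelSup φ) ^ 2 := by
  have hd := hφ.diffContOnCl
  have hcl : closure (ball (0 : ℂ) 1) = closedBall 0 1 := closure_ball _ one_ne_zero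
  have hne : ∀ z ∈ closedBall (0 : ℂ) 1, 1 - conj w * φ z ≠ 0 := by
    intro z hz
    have hz1 : ‖z‖ ≤ 1 := by simpa using hz
    refine one_sub_conj_mul_ne_zero hw ?_
    rcases hz1.lt_or_eq with h | h
    · exact (hφ.norm_lt_one h).le
    · exact (norm_eq_one_of_norm_eq_one hφ hK h).le
  have hne' : ∀ a ∈ s, ∀ z ∈ closedBall (0 : ℂ) 1, 1 - conj a * z ≠ 0 :=
    fun a ha z hz => one_sub_conj_mul_ne_zero (hs a ha) (by simpa using hz)
  -- On the circle the real part is Σ P_a - K P_w ∘ φ ≤ 0. At 0 each term of the sum equals 1, so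
  -- the count of preimages appears.
  have hH : DiffContOnCl ℂ (fun z => ∑ a ∈ s, (1 + conj a * z) / (1 - conj a * z) -
      kernelSup φ * ((1 + conj w * φ z) / (1 - conj w * φ z))) (ball 0 1) := by
    constructor
    · refine DifferentiableOn.sub (DifferentiableOn.fun_sum fun a ha => ?_)
        (DifferentiableOn.const_mul (((hd.differentiableOn.const_mul _).const_add _).div
        ((hd.differentiableOn.const_mul _).const_sub _)
        (fun z hz => hne z (ball_subset_closedBall hz))) _)
      exact DifferentiableOn.div (by fun_prop) (by fun_prop)
        (fun z hz => hne' a ha z (ball_subset_closedBall hz))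
    · refine ContinuousOn.sub (continuousOn_finsetSum _ fun a ha => ?_)
        (ContinuousOn.mul continuousOn_const
        ((continuousOn_const.add (continuousOn_const.mul hd.continuousOn)).div
        (continuousOn_const.sub (continuousOn_const.mul hd.continuousOn))
        (fun z hz => hne z (hcl ▸ hz))))
      exact ContinuousOn.div (by fun_prop) (by fun_prop) (fun z hz => hne' a ha z (hcl ▸ hz))
  have h0 := re_nonpos_of_re_nonpos_on_sphere hH (fun ζ hζ => by
    have hζ1 : ‖ζ‖ = 1 := by simpa using hζ
    have h := sum_poisson_le hφ hK s hs hsw hw hζ1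
    rw [sub_re, re_sum, re_ofReal_mul, re_one_add_div_one_sub]
    simp only [re_one_add_div_one_sub, norm_mul, RCLike.norm_conj, hζ1,
      norm_eq_one_of_norm_eq_one hφ hK hζ1, mul_one]
    linarith) (mem_closedBall_self zero_le_one)
  simp only [mul_zero, add_zero, sub_zero, div_one, Finset.sum_const, nsmul_eq_mul, mul_one,
    sub_re, natCast_re, re_ofReal_mul] at h0
  have hφ0 : ‖φ 0‖ < 1 := hφ.norm_lt_one (by simp)
  have hw0 : ‖conj w * φ 0‖ ≤ ‖φ 0‖ := by
    rw [norm_mul, RCLike.norm_conj]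
    exact mul_le_of_le_one_left (norm_nonneg _) hw.le
  -- Multiplied by K, this bound becomes 16K² = (4K)².
  have h1 : ((1 + conj w * φ 0) / (1 - conj w * φ 0)).re ≤ 2 * (8 * kernelSup φ) := by
    refine (re_le_norm _).trans ?_
    rw [norm_div]
    have hlow : 1 - ‖φ 0‖ ≤ ‖1 - conj w * φ 0‖ := by
      have := norm_sub_norm_le (1 : ℂ) (conj w * φ 0)
      rw [norm_one] at this
      linarith
    have hup : ‖1 + conj w * φ 0‖ ≤ 2 := by
      have := norm_add_le (1 : ℂ) (conj w * φ 0)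
      rw [norm_one] at this
      linarith
    calc ‖1 + conj w * φ 0‖ / ‖1 - conj w * φ 0‖ ≤ 2 / (1 - ‖φ 0‖) :=
          div_le_div₀ zero_le_two hup (by linarith) hlow
      _ = 2 * (1 / (1 - ‖φ 0‖)) := by ring
      _ ≤ _ := by gcongr; exact one_div_one_sub_norm_le hφ hK
  have := mul_le_mul_of_nonneg_left h1 (kernelSup_nonneg φ)
  nlinarith

end SelfMap
-- Change of variables for non-injective holomorphic maps
open scoped ENNReal

/-- The lower integral is superadditive without any measurability, which lets the weights in the
change of variables be arbitrary functions. -/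
theorem sum_lintegral_le_lintegral_sum {α ι : Type*} [MeasurableSpace α] (μ : Measure α)
    (s : Finset ι) (f : ι → α → ℝ≥0∞) :
    ∑ i ∈ s, ∫⁻ x, f i x ∂μ ≤ ∫⁻ x, ∑ i ∈ s, f i x ∂μ := by
  classical
  induction s using Finset.induction_on with
  | empty => simp
  | insert a s has ih =>
    simp only [Finset.sum_insert has]
    exact (add_le_add_right ih _).trans (le_lintegral_add _ _)

theorem abs_det_fderiv_restrictScalars (c : ℂ) :
    ENNReal.ofReal |((ContinuousLinearMap.toSpanSingleton ℂ c).restrictScalars ℝ).det| =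
      ‖c‖ₑ ^ 2 := by
  have : ((ContinuousLinearMap.toSpanSingleton ℂ c).restrictScalars ℝ).det = ‖c‖ ^ 2 := by
    simp [ContinuousLinearMap.det, LinearMap.det_restrictScalars, Algebra.norm_complex_eq,
      Complex.normSq_eq_norm_sq]
  rw [this, abs_of_nonneg (by positivity), ENNReal.ofReal_pow (norm_nonneg _), ofReal_norm]

/-- Change of variables for a holomorphic map that need not be injective, as an inequality. -/
theorem lintegral_comp_mul_le {φ : ℂ → ℂ} {U V : Set ℂ} (hU : IsOpen U) (hV : MeasurableSet V)
    (hφ : DifferentiableOn ℂ φ U) (hUV : MapsTo φ U V) (G H B : ℂ → ℝ≥0∞)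
    (hB : ∀ w ∈ V, ∀ s : Finset ℂ, (∀ a ∈ s, a ∈ U) → (∀ a ∈ s, φ a = w) →
      ∑ a ∈ s, H a ≤ B w) :
    ∫⁻ z in U, ‖deriv φ z‖ₑ ^ 2 * (G (φ z) * H z) ≤ ∫⁻ w in V, G w * B w := by
  classical
  -- Critical points contribute nothing, since the integrand carries |φ'|². Off them φ is locally
  -- injective, and by the Lindelöf property countably many disjoint pieces of injectivity suffice.
  set U' : Set ℂ := U ∩ deriv φ ⁻¹' {0}ᶜ with hU'
  have hU'o : IsOpen U' :=
    (hφ.deriv hU).continuousOn.isOpen_inter_preimage hU isOpen_compl_singleton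
  have hloc : ∀ z, ∃ O : Set ℂ, IsOpen O ∧ InjOn φ O ∧ (z ∈ U' → z ∈ O) := by
    intro z
    by_cases hz : z ∈ U'
    · have hs : HasStrictDerivAt φ (deriv φ z) z :=
        (hφ.analyticAt (hU.mem_nhds hz.1)).hasStrictDerivAt
      have hs' := hs.hasStrictFDerivAt_equiv hz.2
      refine ⟨(hs'.toOpenPartialHomeomorph φ).source,
        (hs'.toOpenPartialHomeomorph φ).open_source, ?_,
        fun _ => hs'.mem_toOpenPartialHomeomorph_source⟩
      have := (hs'.toOpenPartialHomeomorph φ).injOn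
      rwa [hs'.toOpenPartialHomeomorph_coe] at this
    · exact ⟨∅, isOpen_empty, injOn_empty _, fun h => absurd h hz⟩
  choose O hOo hOi hOm using hloc
  obtain ⟨t, -, htc, htU⟩ := TopologicalSpace.countable_cover_nhdsWithin (f := O) (s := U')
    (fun x hx => mem_nhdsWithin_of_mem_nhds ((hOo x).mem_nhds (hOm x hx)))
  obtain ⟨e, he⟩ := countable_iff_exists_subset_range.mp htc
  set A : ℕ → Set ℂ := fun n => U' ∩ disjointed (fun n => O (e n)) n with hA
  have hAU : ⋃ n, A n = U' := by
    rw [hA, ← inter_iUnion, iUnion_disjointed, inter_eq_left]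
    intro z hz
    obtain ⟨x, hx, hzx⟩ := mem_iUnion₂.mp (htU hz)
    obtain ⟨n, rfl⟩ := he hx
    exact mem_iUnion.mpr ⟨n, hzx⟩
  have hAm : ∀ n, MeasurableSet (A n) := fun n =>
    hU'o.measurableSet.inter (MeasurableSet.disjointed (fun n => (hOo (e n)).measurableSet) n)
  have hAd : Pairwise (Function.onFun Disjoint A) := fun i j hij =>
    (disjoint_disjointed (fun n => O (e n)) hij).mono inter_subset_right inter_subset_right
  have hAi : ∀ n, InjOn φ (A n) := fun n =>
    (hOi (e n)).mono (inter_subset_right.trans (disjointed_subset _ _))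
  have hAsub : ∀ n, A n ⊆ U := fun n z hz => hz.1.1
  set g : ℕ → ℂ → ℝ≥0∞ := fun n w => G w * H (Function.invFunOn φ (A n) w) with hg
  have hpiece : ∀ n, ∫⁻ z in A n, ‖deriv φ z‖ₑ ^ 2 * (G (φ z) * H z) =
      ∫⁻ w, (φ '' A n).indicator (g n) w := by
    intro n
    have hd : ∀ x ∈ A n, HasFDerivWithinAt φ
        ((ContinuousLinearMap.toSpanSingleton ℂ (deriv φ x)).restrictScalars ℝ) (A n) x := by
      intro x hx
      have := (hφ.differentiableAt (hU.mem_nhds (hAsub n hx))).hasDerivAt.hasFDerivAt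
      exact (this.restrictScalars ℝ).hasFDerivWithinAt
    rw [lintegral_indicator (measurable_image_of_fderivWithin (hAm n) hd (hAi n)),
      lintegral_image_eq_lintegral_abs_det_fderiv_mul volume (hAm n) hd (hAi n)]
    refine setLIntegral_congr_fun (hAm n) fun z hz => ?_
    simp only [hg]
    rw [abs_det_fderiv_restrictScalars, (hAi n).leftInvOn_invFunOn hz]
  have hzero : ∫⁻ z in U, ‖deriv φ z‖ₑ ^ 2 * (G (φ z) * H z) =
      ∫⁻ z in U', ‖deriv φ z‖ₑ ^ 2 * (G (φ z) * H z) := by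
    rw [← lintegral_inter_add_sdiff _ U hU'o.measurableSet,
      inter_eq_right.mpr (show U' ⊆ U from inter_subset_left)]
    rw [setLIntegral_congr_fun (g := fun _ => 0) (hU.measurableSet.diff hU'o.measurableSet)]
    · simp
    · intro z hz
      have : deriv φ z = 0 := by
        by_contra h
        exact hz.2 ⟨hz.1, h⟩
      simp [this]
  rw [hzero, ← hAU, lintegral_iUnion hAm hAd, ENNReal.tsum_eq_iSup_sum]
  refine iSup_le fun s => ?_
  simp only [hpiece]
  refine (sum_lintegral_le_lintegral_sum _ _ _).trans ?_
  rw [← lintegral_indicator hV]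
  refine lintegral_mono fun w => ?_
  by_cases hw : w ∈ V
  · rw [indicator_of_mem hw]
    have hmem : ∀ n ∈ s.filter (fun n => w ∈ φ '' A n), Function.invFunOn φ (A n) w ∈ A n :=
      fun n hn => Function.invFunOn_mem (Finset.mem_filter.mp hn).2
    have hval : ∀ n ∈ s.filter (fun n => w ∈ φ '' A n), φ (Function.invFunOn φ (A n) w) = w :=
      fun n hn => Function.invFunOn_eq (Finset.mem_filter.mp hn).2
    simp only [indicator_apply]
    rw [← Finset.sum_filter]
    simp only [hg]
    rw [← Finset.mul_sum]
    gcongr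
    -- The pieces are disjoint, so the chosen preimages of w are distinct and form a finite set to
    -- which `hB` applies.
    rw [← Finset.sum_image (f := H) (g := fun n => Function.invFunOn φ (A n) w)]
    · refine hB w hw _ ?_ ?_
      · intro a ha
        obtain ⟨n, hn, rfl⟩ := Finset.mem_image.mp ha
        exact hAsub n (hmem n hn)
      · intro a ha
        obtain ⟨n, hn, rfl⟩ := Finset.mem_image.mp ha
        exact hval n hn
    · intro i hi j hj hij
      by_contra hne
      refine disjoint_left.mp (hAd hne) (hmem i hi) ?_
      have : Function.invFunOn φ (A i) w = Function.invFunOn φ (A j) w := hij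
      rw [this]
      exact hmem j hj
  · rw [indicator_of_notMem hw]
    refine (Finset.sum_eq_zero fun n _ => indicator_of_notMem ?_ _).le
    rintro ⟨z, hz, rfl⟩
    exact hw (hUV (hAsub n hz))

/-! ### The Dirichlet integral of a composition -/

variable {φ : ℂ → ℂ}

/-- Weighted count of preimages. -/
theorem sum_one_sub_norm_sq_rpow_le (hφ : IsC1SelfMap φ) (hK : BddAbove (kernelValues φ))
    {p q : ℝ} (hp : 0 < p) (hpq : p ≤ q) (hq : 2 ≤ q)
    (s : Finset ℂ) {w : ℂ} (hs : ∀ a ∈ s, ‖a‖ < 1) (hsw : ∀ a ∈ s, φ a = w) (hw : ‖w‖ < 1) :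
    ∑ a ∈ s, (1 - ‖a‖ ^ 2) ^ p ≤ 2 * (4 * kernelSup φ) ^ q * (1 - ‖w‖ ^ 2) ^ p := by
  have hK1 := one_le_four_mul_kernelSup hφ hK
  have hsum := sum_one_sub_norm_sq_le hφ hK s hs hsw hw
  have hcard := card_preimages_le hφ hK s hs hsw hw
  set k := 4 * kernelSup φ with hk
  have hW : 0 < 1 - ‖w‖ ^ 2 := by nlinarith [norm_nonneg w]
  set W := 1 - ‖w‖ ^ 2 with hWdef
  have hpos : ∀ a ∈ s, 0 < 1 - ‖a‖ ^ 2 := fun a ha => by nlinarith [norm_nonneg a, hs a ha]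
  have hk0 : 0 < k := by linarith
  have hsq : k ^ 2 ≤ k ^ q := by
    rw [← Real.rpow_natCast]; exact Real.rpow_le_rpow_of_exponent_le hK1 (by simpa using hq)
  have hkq : 0 < k ^ q := Real.rpow_pos_of_pos hk0 q
  rcases le_total 1 p with h1 | h1
  · have hT : 0 < k * W := mul_pos hk0 hW
    -- For p ≥ 1: each x = (1 - |a|²)/(kW) is at most 1, hence x^p ≤ x, and these x have sum at most
    -- 1.
    have hterm : ∀ a ∈ s, (1 - ‖a‖ ^ 2) ^ p ≤ (k * W) ^ p * ((1 - ‖a‖ ^ 2) / (k * W)) := by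
      intro a ha
      have hle : (1 - ‖a‖ ^ 2) / (k * W) ≤ 1 := by
        rw [div_le_one hT]
        exact (Finset.single_le_sum (f := fun a : ℂ => 1 - ‖a‖ ^ 2)
          (fun b hb => (hpos b hb).le) ha).trans hsum
      have h2 := Real.rpow_le_rpow_of_exponent_ge (div_pos (hpos a ha) hT) hle h1
      rw [Real.rpow_one, Real.div_rpow (hpos a ha).le hT.le,
        div_le_iff₀ (Real.rpow_pos_of_pos hT p)] at h2
      linarith
    calc ∑ a ∈ s, (1 - ‖a‖ ^ 2) ^ p
        ≤ ∑ a ∈ s, (k * W) ^ p * ((1 - ‖a‖ ^ 2) / (k * W)) := Finset.sum_le_sum hterm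
      _ = (k * W) ^ p * ((∑ a ∈ s, (1 - ‖a‖ ^ 2)) / (k * W)) := by
        rw [← Finset.mul_sum, ← Finset.sum_div]
      _ ≤ (k * W) ^ p * 1 := by
        gcongr
        exact (div_le_one hT).mpr hsum
      _ = k ^ p * W ^ p := by rw [mul_one, Real.mul_rpow hk0.le hW.le]
      _ ≤ (2 * k ^ q) * W ^ p := by
        gcongr
        linarith [Real.rpow_le_rpow_of_exponent_le hK1 hpq]
  -- For p ≤ 1: x^p ≤ 1 + x with x = (1 - |a|²)/W. The ones add up to the number of preimages, at
  -- most k², and the x to at most k.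
  · have hterm : ∀ a ∈ s, (1 - ‖a‖ ^ 2) ^ p ≤ W ^ p * (1 + (1 - ‖a‖ ^ 2) / W) := by
      intro a ha
      have h0 : 0 ≤ (1 - ‖a‖ ^ 2) / W := (div_pos (hpos a ha) hW).le
      have h2 : ((1 - ‖a‖ ^ 2) / W) ^ p ≤ 1 + (1 - ‖a‖ ^ 2) / W := by
        rcases le_total ((1 - ‖a‖ ^ 2) / W) 1 with h | h
        · linarith [Real.rpow_le_one h0 h hp.le]
        · have := Real.rpow_le_rpow_of_exponent_le h h1
          rw [Real.rpow_one] at this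
          linarith
      rw [Real.div_rpow (hpos a ha).le hW.le, div_le_iff₀ (Real.rpow_pos_of_pos hW p)] at h2
      linarith
    calc ∑ a ∈ s, (1 - ‖a‖ ^ 2) ^ p
        ≤ ∑ a ∈ s, W ^ p * (1 + (1 - ‖a‖ ^ 2) / W) := Finset.sum_le_sum hterm
      _ = W ^ p * (s.card + (∑ a ∈ s, (1 - ‖a‖ ^ 2)) / W) := by
        rw [← Finset.mul_sum, Finset.sum_add_distrib, Finset.sum_div]; simp
      _ ≤ W ^ p * (k ^ 2 + k) := by
        gcongr
        rwa [div_le_iff₀ hW]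
      _ ≤ W ^ p * (2 * k ^ q) := by
        gcongr
        nlinarith
      _ = _ := by ring

theorem lintegral_deriv_comp_le (hφ : IsC1SelfMap φ) (hK : BddAbove (kernelValues φ))
    {p q : ℝ} (hp : 0 < p) (hpq : p ≤ q) (hq : 2 ≤ q) {f : ℂ → ℂ}
    (hf : DifferentiableOn ℂ f disc) :
    ∫⁻ z in disc, ENNReal.ofReal (‖deriv (f ∘ φ) z‖ ^ 2 * (1 - ‖z‖ ^ 2) ^ p) ≤
      ENNReal.ofReal (2 * (4 * kernelSup φ) ^ q) *
        ∫⁻ w in disc, ENNReal.ofReal (‖deriv f w‖ ^ 2 * (1 - ‖w‖ ^ 2) ^ p) := by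
  have hdm : MeasurableSet disc := measurableSet_ball
  have hdo : IsOpen disc := isOpen_ball
  have hC : 0 ≤ 2 * (4 * kernelSup φ) ^ q :=
    mul_nonneg zero_le_two (Real.rpow_nonneg (mul_nonneg zero_le_four (kernelSup_nonneg φ)) q)
  have hw0 : ∀ z ∈ disc, 0 ≤ 1 - ‖z‖ ^ 2 := by
    intro z hz
    have : ‖z‖ < 1 := by simpa [disc] using hz
    nlinarith [norm_nonneg z]
  rw [← lintegral_const_mul' _ _ ENNReal.ofReal_ne_top]
  calc ∫⁻ z in disc, ENNReal.ofReal (‖deriv (f ∘ φ) z‖ ^ 2 * (1 - ‖z‖ ^ 2) ^ p)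
      = ∫⁻ z in disc, ‖deriv φ z‖ₑ ^ 2 *
          (‖deriv f (φ z)‖ₑ ^ 2 * ENNReal.ofReal ((1 - ‖z‖ ^ 2) ^ p)) := by
        refine setLIntegral_congr_fun hdm fun z hz => ?_
        rw [deriv_comp z (hf.differentiableAt (hdo.mem_nhds (hφ.mapsTo hz)))
          (hφ.holo.differentiableAt (hdo.mem_nhds hz)), ENNReal.ofReal_mul (by positivity),
          norm_mul, mul_pow, ENNReal.ofReal_mul (by positivity),
          ENNReal.ofReal_pow (norm_nonneg _), ENNReal.ofReal_pow (norm_nonneg _),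
          ofReal_norm, ofReal_norm]
        ring
    _ ≤ ∫⁻ w in disc, ‖deriv f w‖ₑ ^ 2 *
          ENNReal.ofReal (2 * (4 * kernelSup φ) ^ q * (1 - ‖w‖ ^ 2) ^ p) := by
        refine lintegral_comp_mul_le hdo hdm hφ.holo hφ.mapsTo (fun w => ‖deriv f w‖ₑ ^ 2)
          (fun z => ENNReal.ofReal ((1 - ‖z‖ ^ 2) ^ p))
          (fun w => ENNReal.ofReal (2 * (4 * kernelSup φ) ^ q * (1 - ‖w‖ ^ 2) ^ p)) ?_
        intro w hw s hs hsw
        rw [← ENNReal.ofReal_sum_of_nonneg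
          (fun a ha => Real.rpow_nonneg (hw0 a (hs a ha)) p)]
        exact ENNReal.ofReal_le_ofReal (sum_one_sub_norm_sq_rpow_le hφ hK hp hpq hq s
          (fun a ha => by simpa [disc] using hs a ha) hsw (by simpa [disc] using hw))
    _ = _ := by
        refine setLIntegral_congr_fun hdm fun w hw => ?_
        rw [ENNReal.ofReal_mul hC, ENNReal.ofReal_mul (sq_nonneg ‖deriv f w‖),
          ENNReal.ofReal_pow (norm_nonneg _), ofReal_norm]
        ring

theorem aestronglyMeasurable_dirichlet_integrand {p : ℝ} {f : ℂ → ℂ}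
    (hf : DifferentiableOn ℂ f disc) :
    AEStronglyMeasurable (fun z : ℂ => ‖deriv f z‖ ^ 2 * (1 - ‖z‖ ^ 2) ^ p)
      (volume.restrict disc) := by
  refine ContinuousOn.aestronglyMeasurable ?_ measurableSet_ball
  refine ((hf.deriv isOpen_ball).continuousOn.norm.pow 2).mul
    (ContinuousOn.rpow_const (by fun_prop) fun z hz => Or.inl ?_)
  have : ‖z‖ < 1 := by simpa [disc] using hz
  nlinarith [norm_nonneg z]

theorem dirichlet_integrand_nonneg (p : ℝ) (f : ℂ → ℂ) :
    0 ≤ᵐ[volume.restrict disc] fun z : ℂ => ‖deriv f z‖ ^ 2 * (1 - ‖z‖ ^ 2) ^ p := by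
  filter_upwards [ae_restrict_mem measurableSet_ball] with z hz
  have : ‖z‖ < 1 := mem_ball_zero_iff.mp hz
  exact mul_nonneg (sq_nonneg _) (Real.rpow_nonneg (by nlinarith [norm_nonneg z]) p)

theorem memDirichlet_comp_and_integral_le (hφ : IsC1SelfMap φ) (hK : BddAbove (kernelValues φ))
    {p q : ℝ} (hp : 0 < p) (hpq : p ≤ q) (hq : 2 ≤ q) {f : ℂ → ℂ} (hf : MemDirichlet p f) :
    MemDirichlet p (f ∘ φ) ∧ dirichletIntegral p (f ∘ φ) ≤
      2 * (4 * kernelSup φ) ^ q * dirichletIntegral p f := by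
  have hC : 0 ≤ 2 * (4 * kernelSup φ) ^ q :=
    mul_nonneg zero_le_two (Real.rpow_nonneg (mul_nonneg zero_le_four (kernelSup_nonneg φ)) q)
  have hd : DifferentiableOn ℂ (f ∘ φ) disc := hf.1.comp hφ.holo hφ.mapsTo
  have hle := lintegral_deriv_comp_le hφ hK hp hpq hq hf.1
  have hfin := hf.2.lintegral_lt_top
  rw [← ofReal_integral_eq_lintegral_ofReal hf.2 (dirichlet_integrand_nonneg p f),
    ← ENNReal.ofReal_mul hC] at hle
  have hint : IntegrableOn (fun z : ℂ => ‖deriv (f ∘ φ) z‖ ^ 2 * (1 - ‖z‖ ^ 2) ^ p) disc volume :=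
    (lintegral_ofReal_ne_top_iff_integrable (aestronglyMeasurable_dirichlet_integrand hd)
      (dirichlet_integrand_nonneg p _)).mp (hle.trans_lt ENNReal.ofReal_lt_top).ne
  refine ⟨⟨hd, hint⟩, ?_⟩
  rw [← ofReal_integral_eq_lintegral_ofReal hint (dirichlet_integrand_nonneg p _),
    ENNReal.ofReal_le_ofReal_iff
      (mul_nonneg hC (integral_nonneg_of_ae (dirichlet_integrand_nonneg p f)))] at hle
  unfold dirichletIntegral
  have := mul_le_mul_of_nonneg_left hle (one_div_nonneg.mpr Real.pi_pos.le)
  linarith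

/-! ### Mean values and pointwise growth -/

theorem circleMap_eq_add_polarCoord_symm (c : ℂ) (r θ : ℝ) :
    circleMap c r θ = c + Complex.polarCoord.symm (r, θ) := by
  rw [Complex.polarCoord_symm_apply, circleMap, exp_mul_I, ofReal_cos, ofReal_sin]

theorem mul_enorm_le_lintegral_circle {h : ℂ → ℂ} {c : ℂ} {r R : ℝ}
    (hh : DifferentiableOn ℂ h (ball c R)) (hr : 0 < r) (hrR : r < R) :
    ENNReal.ofReal (2 * Real.pi) * ‖h c‖ₑ ≤
      ∫⁻ θ in Ioo (-Real.pi) Real.pi, ‖h (c + Complex.polarCoord.symm (r, θ))‖ₑ := by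
  have hsub : closedBall c |r| ⊆ ball c R := by
    rw [abs_of_pos hr]; exact closedBall_subset_ball hrR
  have hd : DifferentiableOn ℂ h (closedBall c |r|) := hh.mono hsub
  have hav : Real.circleAverage h c r = h c :=
    circleAverage_of_differentiable_on_off_countable countable_empty hd.continuousOn
      fun z hz => hh.differentiableAt (isOpen_ball.mem_nhds (hsub (ball_subset_closedBall hz.1)))
  have hper : Function.Periodic (fun θ => h (circleMap c r θ)) (2 * Real.pi) := fun θ => by
    simp only [periodic_circleMap c r θ]
  have h1 : (∫ θ in (-Real.pi)..Real.pi, h (circleMap c r θ)) = (2 * Real.pi) • h c := by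
    have e := hper.intervalIntegral_add_eq 0 (-Real.pi)
    rw [zero_add, show -Real.pi + 2 * Real.pi = Real.pi by ring] at e
    rw [← e, ← hav, Real.circleAverage_def, smul_smul, mul_inv_cancel₀ (by positivity), one_smul]
  have h2 : ‖(2 * Real.pi) • h c‖ₑ = ENNReal.ofReal (2 * Real.pi) * ‖h c‖ₑ := by
    rw [enorm_smul, Real.enorm_of_nonneg (by positivity)]
  rw [← h2, ← h1, intervalIntegral.integral_of_le (by linarith [Real.pi_pos])]
  refine (enorm_integral_le_lintegral_enorm _).trans ?_
  rw [← restrict_Ioo_eq_restrict_Ioc]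
  simp only [circleMap_eq_add_polarCoord_symm, le_refl]

/-- Sub-mean value property over discs. -/
theorem mul_enorm_le_lintegral_ball {h : ℂ → ℂ} {c : ℂ} {R : ℝ} (hR : 0 < R)
    (hh : DifferentiableOn ℂ h (ball c R)) :
    ENNReal.ofReal (Real.pi * R ^ 2) * ‖h c‖ₑ ≤ ∫⁻ u in ball c R, ‖h u‖ₑ := by
  classical
  -- Extension by zero gives a globally measurable function, as needed for Tonelli in polar
  -- coordinates.
  set g : ℂ → ℝ≥0∞ := (ball c R).piecewise (fun u => ‖h u‖ₑ) 0 with hg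
  have hgm : Measurable g :=
    ContinuousOn.measurable_piecewise hh.continuousOn.enorm continuousOn_const measurableSet_ball
  have hpm : Measurable fun p : ℝ × ℝ => c + Complex.polarCoord.symm p := by
    simp only [Complex.polarCoord_symm_apply]
    fun_prop
  have e1 : ∫⁻ u in ball c R, ‖h u‖ₑ = ∫⁻ u, g u := by
    rw [← lintegral_indicator measurableSet_ball, hg, piecewise_eq_indicator]
  have e2 : ∫⁻ u, g u = ∫⁻ r in Ioi (0 : ℝ), ∫⁻ θ in Ioo (-Real.pi) Real.pi,
      ENNReal.ofReal r * g (c + Complex.polarCoord.symm (r, θ)) := by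
    rw [← lintegral_add_left_eq_self g c,
      ← Complex.lintegral_comp_polarCoord_symm (fun u => g (c + u)), polarCoord_target,
      Measure.volume_eq_prod]
    simp only [smul_eq_mul]
    rw [setLIntegral_prod]
    exact ((measurable_fst.ennreal_ofReal).mul (hgm.comp hpm)).aemeasurable
  have e3 : ∀ r ∈ Ioo 0 R, ENNReal.ofReal (2 * Real.pi * r) * ‖h c‖ₑ ≤
      ∫⁻ θ in Ioo (-Real.pi) Real.pi,
        ENNReal.ofReal r * g (c + Complex.polarCoord.symm (r, θ)) := by
    intro r hr
    rw [lintegral_const_mul' _ _ ENNReal.ofReal_ne_top, mul_comm (2 * Real.pi),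
      ENNReal.ofReal_mul hr.1.le, mul_assoc]
    gcongr
    refine (mul_enorm_le_lintegral_circle hh hr.1 hr.2).trans_eq ?_
    refine lintegral_congr fun θ => ?_
    rw [hg, piecewise_eq_of_mem]
    rw [← circleMap_eq_add_polarCoord_symm]
    exact sphere_subset_ball hr.2 (circleMap_mem_sphere c hr.1.le θ)
  have e4 : ∫⁻ r in Ioo 0 R, ENNReal.ofReal (2 * Real.pi * r) =
      ENNReal.ofReal (Real.pi * R ^ 2) := by
    rw [← ofReal_integral_eq_lintegral_ofReal]
    · rw [restrict_Ioo_eq_restrict_Ioc, ← intervalIntegral.integral_of_le hR.le]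
      congr 1
      rw [intervalIntegral.integral_const_mul, integral_id]
      ring
    · exact (Continuous.integrableOn_Icc (by fun_prop)).mono_set Ioo_subset_Icc_self
    · filter_upwards [ae_restrict_mem measurableSet_Ioo] with r hr
      have := hr.1
      have := Real.pi_pos
      simp only [Pi.zero_apply]
      positivity
  rw [e1, e2, ← e4, ← lintegral_mul_const' _ _ enorm_ne_top]
  refine le_trans ?_ (lintegral_mono_set (Ioo_subset_Ioi_self : Ioo 0 R ⊆ Ioi 0))
  exact setLIntegral_mono' measurableSet_Ioo e3

/-- Pointwise growth of the derivative of a function in the Dirichlet-type space. -/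
theorem norm_deriv_sq_le {p : ℝ} (hp : 0 < p) {f : ℂ → ℂ} (hf : MemDirichlet p f) {z : ℂ}
    (hz : ‖z‖ < 1) :
    ‖deriv f z‖ ^ 2 ≤ dirichletIntegral p f * (2 / (1 - ‖z‖)) ^ (p + 2) := by
  -- On the disc of this radius about z, 1 - |u|² ≥ 1 - |u| ≥ R, so the weight is at least R^p. The
  -- mean value inequality is then applied to (f')².
  set R := (1 - ‖z‖) / 2 with hRdef
  have hR : 0 < R := by rw [hRdef]; linarith
  have hsub : ball z R ⊆ disc := by
    intro u hu
    have h1 : ‖u - z‖ < R := by simpa [dist_eq_norm] using hu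
    have : ‖u‖ < 1 := by
      have := norm_sub_norm_le u z
      linarith
    simpa [disc] using this
  have hw : ∀ u ∈ ball z R, R ^ p ≤ (1 - ‖u‖ ^ 2) ^ p := by
    intro u hu
    have h1 : ‖u - z‖ < R := by simpa [dist_eq_norm] using hu
    have h2 := norm_sub_norm_le u z
    refine Real.rpow_le_rpow hR.le ?_ hp.le
    nlinarith [norm_nonneg u]
  have hdf : DifferentiableOn ℂ (deriv f) disc := hf.1.deriv isOpen_ball
  have hmean := mul_enorm_le_lintegral_ball hR (h := fun u => deriv f u ^ 2)
    ((hdf.mono hsub).pow 2)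
  have hI := integral_nonneg_of_ae (dirichlet_integrand_nonneg p f)
  have hRp : 0 < R ^ p := Real.rpow_pos_of_pos hR p
  have hupper : ENNReal.ofReal (R ^ p) * ∫⁻ u in ball z R, ‖deriv f u ^ 2‖ₑ ≤
      ENNReal.ofReal (∫ u in disc, ‖deriv f u‖ ^ 2 * (1 - ‖u‖ ^ 2) ^ p) := by
    rw [← lintegral_const_mul' _ _ ENNReal.ofReal_ne_top,
      ofReal_integral_eq_lintegral_ofReal hf.2 (dirichlet_integrand_nonneg p f)]
    refine le_trans ?_ (lintegral_mono_set hsub)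
    refine setLIntegral_mono' measurableSet_ball fun u hu => ?_
    rw [← ofReal_norm, ← ENNReal.ofReal_mul hRp.le, norm_pow, mul_comm]
    exact ENNReal.ofReal_le_ofReal (mul_le_mul_of_nonneg_left (hw u hu) (sq_nonneg _))
  have hall : R ^ p * (Real.pi * R ^ 2 * ‖deriv f z‖ ^ 2) ≤
      ∫ u in disc, ‖deriv f u‖ ^ 2 * (1 - ‖u‖ ^ 2) ^ p := by
    rw [← ENNReal.ofReal_le_ofReal_iff hI, ENNReal.ofReal_mul hRp.le,
      ENNReal.ofReal_mul (by positivity), ← norm_pow, ofReal_norm]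
    exact (mul_le_mul_right hmean _).trans hupper
  have e : (2 / (1 - ‖z‖)) ^ (p + 2) = 1 / (R ^ p * R ^ 2) := by
    rw [show 2 / (1 - ‖z‖) = R⁻¹ by rw [hRdef, inv_div], Real.inv_rpow hR.le, Real.rpow_add hR,
      Real.rpow_two, one_div]
  rw [e, mul_one_div, le_div_iff₀ (by positivity), dirichletIntegral, one_div_mul_eq_div,
    le_div_iff₀ Real.pi_pos]
  linarith

theorem dirichletIntegral_nonneg (p : ℝ) (f : ℂ → ℂ) : 0 ≤ dirichletIntegral p f :=
  mul_nonneg (one_div_nonneg.mpr Real.pi_pos.le)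
    (integral_nonneg_of_ae (dirichlet_integrand_nonneg p f))

/-- Pointwise growth of a function in the Dirichlet-type space. -/
theorem norm_sub_sq_le {p : ℝ} (hp : 0 < p) {f : ℂ → ℂ} (hf : MemDirichlet p f) {a : ℂ}
    (ha : ‖a‖ < 1) :
    ‖f a - f 0‖ ^ 2 ≤
      (2 ^ (p / 2 + 1) * (2 / p)) ^ 2 * (1 / (1 - ‖a‖)) ^ p * dirichletIntegral p f := by
  set D := dirichletIntegral p f with hD
  have hD0 : 0 ≤ D := dirichletIntegral_nonneg p f
  set M := Real.sqrt D * 2 ^ (p / 2 + 1) with hM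
  have hM0 : 0 ≤ M := by positivity
  have hderiv : ∀ z : ℂ, ‖z‖ < 1 → ‖deriv f z‖ ≤ M * (1 - ‖z‖) ^ (-(p / 2) - 1) := by
    intro z hz
    have h1 : 0 < 1 - ‖z‖ := by linarith
    have h := Real.sqrt_le_sqrt (norm_deriv_sq_le hp hf hz)
    rw [Real.sqrt_sq (norm_nonneg _), Real.sqrt_mul hD0] at h
    refine h.trans_eq ?_
    rw [hM, mul_assoc]
    congr 1
    rw [Real.sqrt_eq_rpow, ← Real.rpow_mul (by positivity), Real.div_rpow zero_le_two h1.le,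
      show (p + 2) * (1 / 2) = p / 2 + 1 by ring, show -(p / 2) - 1 = -(p / 2 + 1) by ring,
      Real.rpow_neg h1.le]
    rfl
  have hta : ∀ t ∈ Icc (0 : ℝ) 1, ‖(t : ℂ) * a‖ = t * ‖a‖ ∧ t * ‖a‖ < 1 := by
    intro t ht
    refine ⟨by rw [norm_mul, norm_real, Real.norm_of_nonneg ht.1], ?_⟩
    nlinarith [ht.1, ht.2, norm_nonneg a]
  have hdiff : ∀ t ∈ Icc (0 : ℝ) 1,
      HasDerivAt (fun t : ℝ => f (t * a) - f 0) (deriv f (t * a) * a) t := by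
    intro t ht
    have hmem : (t : ℂ) * a ∈ disc := by
      have := hta t ht
      simp only [disc, mem_ball_zero_iff]
      linarith
    have h1 := (hf.1.differentiableAt (isOpen_ball.mem_nhds hmem)).hasDerivAt
    have h2 : HasDerivAt (fun t : ℝ => (t : ℂ) * a) a t := by
      simpa using (ofRealCLM.hasDerivAt (x := t)).mul_const a
    exact (h1.comp t h2).sub_const _
  have hBd : ∀ t ∈ Icc (0 : ℝ) 1, HasDerivAt (fun t : ℝ => M * (2 / p) * (1 - t * ‖a‖) ^ (-(p / 2)))
      (M * (1 - t * ‖a‖) ^ (-(p / 2) - 1) * ‖a‖) t := by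
    intro t ht
    have hpos : 1 - t * ‖a‖ ≠ 0 := by linarith [(hta t ht).2]
    have h1 : HasDerivAt (fun t : ℝ => 1 - t * ‖a‖) (-‖a‖) t := by
      simpa using ((hasDerivAt_id t).mul_const ‖a‖).const_sub 1
    have h2 := (h1.rpow_const (p := -(p / 2)) (Or.inl hpos)).const_mul (M * (2 / p))
    exact h2.congr_deriv (by field_simp)
  -- The comparison function is an antiderivative in t of the bound for |d/dt f(ta)|. Its positive
  -- value at t = 0 is harmless, as the curve starts at 0.
  have hfin := image_norm_le_of_norm_deriv_right_le_deriv_boundary' (a := 0) (b := 1)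
    (f := fun t : ℝ => f (t * a) - f 0) (f' := fun t : ℝ => deriv f (t * a) * a)
    (B := fun t : ℝ => M * (2 / p) * (1 - t * ‖a‖) ^ (-(p / 2)))
    (B' := fun t : ℝ => M * (1 - t * ‖a‖) ^ (-(p / 2) - 1) * ‖a‖)
    (fun t ht => (hdiff t ht).continuousAt.continuousWithinAt)
    (fun t ht => (hdiff t (Ico_subset_Icc_self ht)).hasDerivWithinAt)
    (by simp; positivity)
    (fun t ht => (hBd t ht).continuousAt.continuousWithinAt)
    (fun t ht => (hBd t (Ico_subset_Icc_self ht)).hasDerivWithinAt)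
    (fun t ht => by
      have h := hta t (Ico_subset_Icc_self ht)
      have h2 := hderiv (t * a) (by rw [h.1]; exact h.2)
      rw [h.1] at h2
      rw [norm_mul]
      gcongr) (right_mem_Icc.mpr zero_le_one)
  simp only [ofReal_one, one_mul] at hfin
  have h1 : 0 < 1 - ‖a‖ := by linarith
  refine (pow_le_pow_left₀ (norm_nonneg _) hfin 2).trans_eq ?_
  have e : ((1 - ‖a‖) ^ (-(p / 2))) ^ 2 = (1 / (1 - ‖a‖)) ^ p := by
    rw [one_div, Real.inv_rpow h1.le, ← Real.rpow_neg h1.le, ← Real.rpow_natCast,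
      ← Real.rpow_mul h1.le]
    congr 1
    push_cast
    ring
  rw [mul_pow, mul_pow, hM, mul_pow, Real.sq_sqrt hD0, e]
  ring

end DirichletDisc

/-! ### Assembly of the constants -/

theorem theorem3p1 (σ β : ℝ) (hσ : 0 < σ) (hβ₁ : σ / 2 - 1 < β) (hβ₂ : β < σ) :
    ∃ C : ℝ, 0 < C ∧ ∀ φ : ℂ → ℂ, DirichletDisc.IsC1SelfMap φ →
      BddAbove (DirichletDisc.kernelValues φ) →
        DirichletDisc.BoundedComposition (2 * σ - 2 * β) φ ∧
        ∀ f : ℂ → ℂ, DirichletDisc.MemDirichlet (2 * σ - 2 * β) f →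
          DirichletDisc.MemDirichlet (2 * σ - 2 * β) (f ∘ φ) ∧
          DirichletDisc.dirichletIntegral (2 * σ - 2 * β) (f ∘ φ) ≤
            C * DirichletDisc.kernelSup φ ^ (2 * (β + 2)) *
              DirichletDisc.dirichletIntegral (2 * σ - 2 * β) f ∧
          DirichletDisc.dirichletNorm (2 * σ - 2 * β) (f ∘ φ) ^ 2 ≤
            C * DirichletDisc.kernelSup φ ^ (2 * (β + 2)) *
              DirichletDisc.dirichletNorm (2 * σ - 2 * β) f ^ 2 := by
  have hp : 0 < 2 * σ - 2 * β := by linarith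
  -- The condition p ≤ q amounts to β ≥ σ/2 - 1, and q ≥ 2 to β ≥ -1, which follows since σ > 0.
  have hpq : 2 * σ - 2 * β ≤ 2 * (β + 2) := by linarith
  have hq : 2 ≤ 2 * (β + 2) := by linarith
  set p := 2 * σ - 2 * β
  set q := 2 * (β + 2)
  set G : ℝ := (2 ^ (p / 2 + 1) * (2 / p)) ^ 2 with hG
  have hG0 : 0 ≤ G := sq_nonneg _
  have h8 : (0 : ℝ) < 8 ^ q := Real.rpow_pos_of_pos (by norm_num) q
  -- With E = (8K)^q, the integral costs 2E D_p(f), and |f(φ(0))|² costs 2GE D_p(f) + 2|f(0)|².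
  -- Since E ≥ 1, the factor (4 + 2G)E covers both.
  refine ⟨(4 + 2 * G) * 8 ^ q, by positivity, fun φ hφ hK => ?_⟩
  have hK1 := DirichletDisc.one_le_four_mul_kernelSup hφ hK
  set K := DirichletDisc.kernelSup φ with hKdef
  have hK0 : 0 < K := by linarith
  set E : ℝ := (8 * K) ^ q with hE
  have hEK : (8 : ℝ) ^ q * K ^ q = E := (Real.mul_rpow (by norm_num) hK0.le).symm
  have hE1 : 1 ≤ E := Real.one_le_rpow (by linarith) (by linarith)
  have h4E : (4 * K) ^ q ≤ E := Real.rpow_le_rpow (by linarith) (by linarith) (by linarith)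
  have hpE : (8 * K) ^ p ≤ E := Real.rpow_le_rpow_of_exponent_le (by linarith) hpq
  have main : ∀ f : ℂ → ℂ, DirichletDisc.MemDirichlet p f →
      DirichletDisc.MemDirichlet p (f ∘ φ) ∧
      DirichletDisc.dirichletIntegral p (f ∘ φ) ≤
        (4 + 2 * G) * 8 ^ q * K ^ q * DirichletDisc.dirichletIntegral p f ∧
      DirichletDisc.dirichletNorm p (f ∘ φ) ^ 2 ≤
        (4 + 2 * G) * 8 ^ q * K ^ q * DirichletDisc.dirichletNorm p f ^ 2 := by
    intro f hf
    obtain ⟨hmem, hint⟩ := DirichletDisc.memDirichlet_comp_and_integral_le hφ hK hp hpq hq hf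
    have hD := DirichletDisc.dirichletIntegral_nonneg p f
    have hD' := DirichletDisc.dirichletIntegral_nonneg p (f ∘ φ)
    have hφ0 : ‖φ 0‖ < 1 := hφ.norm_lt_one (by simp)
    have hint' : DirichletDisc.dirichletIntegral p (f ∘ φ) ≤
        2 * E * DirichletDisc.dirichletIntegral p f :=
      hint.trans (by gcongr)
    have hpt : ‖f (φ 0) - f 0‖ ^ 2 ≤ G * E * DirichletDisc.dirichletIntegral p f := by
      refine (DirichletDisc.norm_sub_sq_le hp hf hφ0).trans ?_
      gcongr
      refine le_trans (Real.rpow_le_rpow ?_ (DirichletDisc.one_div_one_sub_norm_le hφ hK) hp.le) hpE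
      exact one_div_nonneg.mpr (by linarith)
    have htri : ‖f (φ 0)‖ ^ 2 ≤ 2 * ‖f (φ 0) - f 0‖ ^ 2 + 2 * ‖f 0‖ ^ 2 := by
      have h := norm_add_le (f (φ 0) - f 0) (f 0)
      rw [sub_add_cancel] at h
      nlinarith [sq_nonneg (‖f (φ 0) - f 0‖ - ‖f 0‖), norm_nonneg (f (φ 0))]
    have hGED : 0 ≤ G * E * DirichletDisc.dirichletIntegral p f := by positivity
    have hED : 0 ≤ E * DirichletDisc.dirichletIntegral p f := by positivity
    refine ⟨hmem, ?_, ?_⟩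
    · rw [mul_assoc _ _ (K ^ q), hEK]
      nlinarith
    · rw [DirichletDisc.dirichletNorm, DirichletDisc.dirichletNorm,
        Real.sq_sqrt (by positivity), Real.sq_sqrt (by positivity), mul_assoc _ _ (K ^ q), hEK,
        Function.comp_apply]
      have h1 : ‖f 0‖ ^ 2 ≤ E * ‖f 0‖ ^ 2 := le_mul_of_one_le_left (sq_nonneg _) hE1
      have h2 : 0 ≤ G * (E * ‖f 0‖ ^ 2) := by positivity
      nlinarith [sq_nonneg ‖f 0‖]
  refine ⟨⟨Real.sqrt ((4 + 2 * G) * 8 ^ q * K ^ q), fun f hf => ?_⟩, main⟩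
  obtain ⟨hmem, -, hn⟩ := main f hf
  refine ⟨hmem, ?_⟩
  refine (pow_le_pow_iff_left₀ (Real.sqrt_nonneg _)
    (mul_nonneg (Real.sqrt_nonneg _) (Real.sqrt_nonneg _)) two_ne_zero).mp ?_
  rwa [mul_pow, Real.sq_sqrt (show 0 ≤ (4 + 2 * G) * 8 ^ q * K ^ q by positivity)]
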